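/- Let $H(13,2)$ be the Hamming graph on the binary words of length $13$, two words being adjacent if they differ in exactly one position. For a nonempty set $C$ of vertices, let $C^{(i)}$ be the set of vertices at graph distance exactly $i$ from $C$. Call $C$ a $\{13,6,1;1,6,9\}$-CR code (a completely regular code with covering radius $3$ and this intersection array) if $C^{(0)},C^{(1)},C^{(2)},C^{(3)}$ are nonempty and partition the vertex set, for all $i,j\in\{0,1,2,3\}$ the number $S_{i,j}$ of neighbors in $C^{(j)}$ of a vertex of $C^{(i)}$ does not depend on the choice of that vertex, and $(S_{0,1},S_{1,2},S_{2,3})=(13,6,1)$, $(S_{1,0},S_{2,1},S_{3,2})=(1,6,9)$. Two codes are equivalent if one is obtained from the other by a permutation of the $13$ coordinates followed by a permutation of the symbols $\{0,1\}$ in each coordinate (in other words, by an automorphism of $H(13,2)$). Then $H(13,2)$ contains a $\{13,6,1;1,6,9\}$-CR code, and any two such codes are equivalent; that is, up to equivalence there is exactly one $\{13,6,1;1,6,9\}$-CR code in $H(13,2)$. -/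

import Mathlib

namespace CRCode

/-- The Hamming graph `H(n,q)`, the Cartesian product of `n` copies of the complete graph of
order `q`: two words are adjacent iff they differ in exactly one position. -/
def hammingGraph (n q : ℕ) : SimpleGraph (Fin n → Fin q) where
  Adj x y := hammingDist x y = 1
  symm := ⟨fun x y h => by rwa [hammingDist_comm]⟩
  loopless := ⟨fun x h => by simp at h⟩

/-- `(P 0, …, P (k-1))` is an equitable partition of the vertices of `G` into nonempty cells, with
quotient matrix `S`: every vertex of `P i` has exactly `S i j` neighbors in `P j`. -/
structure IsEquitablePartition {V : Type*} (G : SimpleGraph V) {k : ℕ} (P : Fin k → Set V)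
    (S : Matrix (Fin k) (Fin k) ℕ) : Prop where
  nonempty : ∀ i, (P i).Nonempty
  disjoint : Pairwise fun i j => Disjoint (P i) (P j)
  cover : ⋃ i, P i = Set.univ
  card_neighbors : ∀ i j, ∀ x ∈ P i, (G.neighborSet x ∩ P j).encard = S i j

/-- The cell `C^{(i)}` of the distance partition: the vertices at graph distance exactly `i`
from the set `C`. -/
def distanceCell {V : Type*} (G : SimpleGraph V) (C : Set V) (i : ℕ) : Set V :=
  {x | (⨅ c ∈ C, G.edist x c) = (i : ℕ∞)}

/-- `C` is a completely regular code in `G` with covering radius `ρ` and intersection array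
`{b 0, …, b (ρ-1); c 0, …, c (ρ-1)}`. The `c`-part is indexed from `0` here, so that `c i` is the
number of neighbors in `C^{(i)}` of a vertex of `C^{(i+1)}`. -/
def IsCRCode {V : Type*} (G : SimpleGraph V) {ρ : ℕ} (b c : Fin ρ → ℕ) (C : Set V) : Prop :=
  C.Nonempty ∧ ∃ S : Matrix (Fin (ρ + 1)) (Fin (ρ + 1)) ℕ,
    IsEquitablePartition G (fun i : Fin (ρ + 1) => distanceCell G C i) S ∧
    ∀ i : Fin ρ, S i.castSucc i.succ = b i ∧ S i.succ i.castSucc = c i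

/-- Equivalence of codes in `H(n,q)`: one is obtained from the other by a permutation of the
coordinates followed by a permutation of the alphabet in each coordinate. -/
def Equivalent {n q : ℕ} (C D : Set (Fin n → Fin q)) : Prop :=
  ∃ (π : Equiv.Perm (Fin n)) (σ : Fin n → Equiv.Perm (Fin q)),
    (fun (x : Fin n → Fin q) (i : Fin n) => σ i (x (π i))) '' C = D

end CRCode

namespace CRCode

open Finset

/-! The array forces the quotient matrix, so codes correspond to equitable 4-colorings, with cells
of sizes 288, 3744, 3744, 416.

Uniqueness rests on the last cell. A vertex of cell 2 has a single neighbor in cell 3, so squares in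
cell 3 close up and the cell is a disjoint union of 4-dimensional subcubes, each encoded by a
ternary word of weight 9 with zeros at the free coordinates. Edge counting determines how the cells
meet the shells around such a subcube (`IsColoring.shell`): code words lie only at distances 3 and
6, so their sign vectors are orthogonal to the ternary word modulo 3; the antipodal subcube is again
in cell 3; and other subcubes are at distance at least 3. The last two facts give two supports an
overlap of at least 6 unless the words agree up to sign, while a double count makes the average
exactly tight (`IsColoring.overlap_eq_six`). Hence the sum of two such words again has weight 9 or
is zero, and orthogonality to the code puts its subcube in cell 3 (`IsColoring.isCube_add`).

With zero, the 416/16 = 26 words thus form a linear ternary code of dimension 3. Its 13 coordinate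
columns are nonzero and pairwise nonproportional, so they are the points of the projective plane up
to sign. After an equivalence the code lies among the ±1 words of the ternary Hamming code;
comparing cardinalities gives uniqueness. Existence is a kernel computation on that example. -/

/-- The binary words of length 13. -/
abbrev Word := Fin 13 → Fin 2

/-- The word `x` with its `i`-th symbol changed. -/
def flip (x : Word) (i : Fin 13) : Word := x + Pi.single i 1

/-- The quotient matrix of a completely regular code with intersection array
`{13, 6, 1; 1, 6, 9}`. -/
def quotientMatrix : Fin 4 → Fin 4 → ℕ :=
  ![![0, 13, 0, 0], ![1, 6, 6, 0], ![0, 6, 6, 1], ![0, 0, 9, 4]]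

/-- A map `c` to `Fin 4` whose fibers form an equitable partition of `H(13,2)` with quotient matrix
`quotientMatrix`. -/
def IsColoring (c : Word → Fin 4) : Prop :=
  ∀ x j, #{i | c (flip x i) = j} = quotientMatrix (c x) j

lemma fin_two_add_one_ne (a : Fin 2) : a + 1 ≠ a := by decide +revert

lemma fin_two_eq_add_one {a b : Fin 2} (h : a ≠ b) : a = b + 1 := by decide +revert

lemma flip_apply_self (x : Word) (i : Fin 13) : flip x i i = x i + 1 := by simp [flip]

lemma flip_apply_of_ne (x : Word) {i j : Fin 13} (h : j ≠ i) : flip x i j = x j := by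
  simp [flip, h]

lemma word_add_self (x : Word) : x + x = 0 := by
  funext i
  have : ∀ a : Fin 2, a + a = 0 := by decide
  exact this (x i)

lemma flip_flip (x : Word) (i : Fin 13) : flip (flip x i) i = x := by
  simp only [flip, add_assoc, word_add_self, add_zero]

lemma flip_comm (x : Word) (i j : Fin 13) : flip (flip x i) j = flip (flip x j) i := by
  simp only [flip, add_assoc, add_comm (Pi.single i (1 : Fin 2) : Word)]

lemma flip_injective (x : Word) : Function.Injective (flip x) := by
  intro i j h
  by_contra hij
  have := congrFun h i
  rw [flip_apply_self, flip_apply_of_ne x hij] at this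
  exact fin_two_add_one_ne _ this

/-- Summation over the edges of `H(13,2)` is symmetric. -/
lemma sum_mul_sum_flip (F G : Word → ℕ) :
    ∑ x, F x * ∑ i, G (flip x i) = ∑ x, G x * ∑ i, F (flip x i) := by
  simp only [mul_sum]
  rw [sum_comm, sum_comm (s := univ) (t := univ) (f := fun x i => G x * F (flip x i))]
  refine sum_congr rfl fun i _ => ?_
  refine Fintype.sum_equiv (Equiv.addRight (Pi.single i 1 : Word)) _ _ fun x => ?_
  change F x * G (flip x i) = G (flip x i) * F (flip (flip x i) i)
  rw [flip_flip, mul_comm]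

/-! ### Local structure and cell sizes of a coloring -/

namespace IsColoring

variable {c : Word → Fin 4}

lemma sum_flip (h : IsColoring c) (x : Word) (j : Fin 4) :
    ∑ i, (if c (flip x i) = j then 1 else 0) = quotientMatrix (c x) j := by
  rw [← h x j, card_filter]

lemma ne_of_eq_zero (h : IsColoring c) {x : Word} {j : Fin 4} (hx : quotientMatrix (c x) j = 0)
    (i : Fin 13) : c (flip x i) ≠ j := by
  rw [← h x j, card_eq_zero, filter_eq_empty_iff] at hx
  exact hx (mem_univ i)

lemma exists_flip (h : IsColoring c) {x : Word} {j : Fin 4} (hx : quotientMatrix (c x) j ≠ 0) :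
    ∃ i, c (flip x i) = j := by
  rw [← h x j, card_ne_zero] at hx
  obtain ⟨i, hi⟩ := hx
  exact ⟨i, by simpa using hi⟩

lemma flip_of_zero (h : IsColoring c) {x : Word} (hx : c x = 0) (i : Fin 13) :
    c (flip x i) = 1 := by
  have h0 := h.ne_of_eq_zero (x := x) (j := 0) (by rw [hx]; rfl) i
  have h2 := h.ne_of_eq_zero (x := x) (j := 2) (by rw [hx]; rfl) i
  have h3 := h.ne_of_eq_zero (x := x) (j := 3) (by rw [hx]; rfl) i
  generalize c (flip x i) = a at *
  decide +revert

lemma flip_of_three (h : IsColoring c) {x : Word} (hx : c x = 3) (i : Fin 13) :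
    c (flip x i) = 2 ∨ c (flip x i) = 3 := by
  have h0 := h.ne_of_eq_zero (x := x) (j := 0) (by rw [hx]; rfl) i
  have h1 := h.ne_of_eq_zero (x := x) (j := 1) (by rw [hx]; rfl) i
  generalize c (flip x i) = a at *
  decide +revert

/-- Both sides count the edges between two cells, one from each end. -/
lemma card_mul (h : IsColoring c) (j k : Fin 4) :
    #{x | c x = j} * quotientMatrix j k = #{x | c x = k} * quotientMatrix k j := by
  have := sum_mul_sum_flip (fun x => if c x = j then 1 else 0) (fun x => if c x = k then 1 else 0)
  simp only [h.sum_flip] at this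
  have key : ∀ a b : Fin 4, ∑ x, (if c x = a then 1 else 0) * quotientMatrix (c x) b =
      #{x | c x = a} * quotientMatrix a b := by
    intro a b
    rw [card_filter, sum_mul]
    refine sum_congr rfl fun x _ => ?_
    split_ifs with hx
    · rw [hx]
    · simp
  rwa [key, key] at this

lemma card_cells (h : IsColoring c) : #{x | c x = 0} = 288 ∧ #{x | c x = 3} = 416 := by
  have h01 : _ * 13 = _ * 1 := h.card_mul 0 1
  have h12 : _ * 6 = _ * 6 := h.card_mul 1 2
  have h23 : _ * 1 = _ * 9 := h.card_mul 2 3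
  have htot : ∑ j : Fin 4, #{x | c x = j} = 8192 := by
    have := card_eq_sum_card_fiberwise (s := (univ : Finset Word)) (t := (univ : Finset (Fin 4)))
      (f := c) (by intro x _; simp)
    rw [← this]
    simp
  simp only [Fin.sum_univ_four] at htot
  omega

end IsColoring

/-! ### Completely regular codes and colorings -/

lemma hammingGraph_adj_flip (x : Word) (i : Fin 13) : (hammingGraph 13 2).Adj x (flip x i) := by
  change hammingDist x (flip x i) = 1
  rw [hammingDist, card_eq_one]
  refine ⟨i, ?_⟩
  ext j
  by_cases hj : j = i
  · subst hj
    simp [flip_apply_self, (fin_two_add_one_ne _).symm]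
  · simp [flip_apply_of_ne x hj, hj]

lemma exists_flip_of_adj {x y : Word} (h : (hammingGraph 13 2).Adj x y) : ∃ i, flip x i = y := by
  change hammingDist x y = 1 at h
  rw [hammingDist, card_eq_one] at h
  obtain ⟨i, hi⟩ := h
  have key : ∀ j, x j ≠ y j ↔ j = i := fun j => by
    have := congrArg (j ∈ ·) hi
    simpa using this
  refine ⟨i, funext fun j => ?_⟩
  by_cases hj : j = i
  · subst hj
    rw [flip_apply_self]
    exact (fin_two_eq_add_one ((key j).2 rfl).symm).symm
  · rw [flip_apply_of_ne x hj]
    exact not_not.1 (mt (key j).1 hj)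

lemma encard_neighborSet_inter (x : Word) (P : Set Word) [DecidablePred (· ∈ P)] :
    ((hammingGraph 13 2).neighborSet x ∩ P).encard = (#{i | flip x i ∈ P} : ℕ) := by
  have : (hammingGraph 13 2).neighborSet x ∩ P = flip x '' {i | flip x i ∈ P} := by
    ext y
    constructor
    · rintro ⟨hy, hP⟩
      obtain ⟨i, rfl⟩ := exists_flip_of_adj hy
      exact ⟨i, hP, rfl⟩
    · rintro ⟨i, hi, rfl⟩
      exact ⟨hammingGraph_adj_flip x i, hi⟩
  rw [this, (flip_injective x).encard_image, ← Set.encard_coe_eq_coe_finsetCard]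
  simp

lemma distanceCell_zero {V : Type*} (G : SimpleGraph V) (C : Set V) : distanceCell G C 0 = C := by
  ext x
  constructor
  · intro hx
    have hx' : (⨅ c ∈ C, G.edist x c) < 1 := by
      rw [show (⨅ c ∈ C, G.edist x c) = ((0 : ℕ) : ℕ∞) from hx]
      simp
    simp only [iInf_lt_iff] at hx'
    obtain ⟨z, hz, hlt⟩ := hx'
    have := SimpleGraph.edist_eq_zero_iff.1 (Order.lt_one_iff.1 hlt)
    rwa [this]
  · intro hx
    refine le_antisymm (iInf₂_le_of_le x hx ?_) ?_ <;> simp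

lemma not_adj_of_mem_distanceCell {V : Type*} {G : SimpleGraph V} {C : Set V} {x y : V} {i j : ℕ}
    (hx : x ∈ distanceCell G C i) (hy : y ∈ distanceCell G C j) (hij : i + 1 < j) :
    ¬ G.Adj x y := by
  intro hadj
  have hx' : (⨅ c ∈ C, G.edist x c) < ((i + 1 : ℕ) : ℕ∞) := by
    rw [show (⨅ c ∈ C, G.edist x c) = (i : ℕ∞) from hx]
    exact_mod_cast Nat.lt_succ_self i
  simp only [iInf_lt_iff] at hx'
  obtain ⟨z, hz, hlt⟩ := hx'
  have hle : (j : ℕ∞) ≤ G.edist y z := by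
    rw [← show (⨅ c ∈ C, G.edist y c) = (j : ℕ∞) from hy]
    exact iInf₂_le z hz
  have h1 : G.edist y x ≤ 1 := by
    rw [SimpleGraph.edist_eq_one_iff_adj.2 hadj.symm]
  have h2 : (j : ℕ∞) ≤ 1 + G.edist x z :=
    hle.trans (SimpleGraph.edist_triangle.trans (by gcongr))
  have h3 : G.edist x z ≤ (i : ℕ∞) := by
    push_cast at hlt
    exact ENat.lt_add_one_iff (ENat.natCast_ne_top i) |>.1 hlt
  have h4 : (j : ℕ∞) ≤ ((1 + i : ℕ) : ℕ∞) := by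
    push_cast
    exact h2.trans (by gcongr)
  have h5 : j ≤ 1 + i := by exact_mod_cast h4
  omega

/-- The cells of the distance partition of a completely regular code are the fibers of a
coloring. -/
lemma exists_isColoring_of_isCRCode {D : Set Word}
    (hD : IsCRCode (hammingGraph 13 2) ![13, 6, 1] ![1, 6, 9] D) :
    ∃ c : Word → Fin 4, IsColoring c ∧ D = {x | c x = 0} := by
  classical
  obtain ⟨-, S, hP, hS⟩ := hD
  set P : Fin 4 → Set Word := fun i => distanceCell (hammingGraph 13 2) D i with hPdef
  have hex : ∀ x, ∃ i, x ∈ P i := fun x => by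
    have : x ∈ ⋃ i, P i := by rw [hP.cover]; trivial
    simpa using this
  choose c hc using hex
  have huniq : ∀ x j, x ∈ P j ↔ c x = j := fun x j => by
    refine ⟨fun hx => ?_, fun hx => hx ▸ hc x⟩
    by_contra hne
    exact Set.disjoint_left.1 (hP.disjoint hne) (hc x) hx
  have hcard : ∀ x j, #{i | c (flip x i) = j} = S (c x) j := fun x j => by
    have := hP.card_neighbors (c x) j x (hc x)
    rw [encard_neighborSet_inter] at this
    simp only [huniq] at this
    exact_mod_cast this
  have hrow : ∀ i : Fin 4, ∑ j : Fin 4, S i j = 13 := fun i => by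
    obtain ⟨x, hx⟩ := hP.nonempty i
    rw [huniq] at hx
    subst hx
    simp only [← hcard]
    have := card_eq_sum_card_fiberwise (s := (univ : Finset (Fin 13)))
      (t := (univ : Finset (Fin 4))) (f := fun i => c (flip x i)) (by intro x _; simp)
    rw [← this]
    simp
  have hfar : ∀ i j : Fin 4, (i : ℕ) + 1 < j → S i j = 0 ∧ S j i = 0 := fun i j hij => by
    constructor
    · obtain ⟨x, hx⟩ := hP.nonempty i
      have hx' := hx
      rw [huniq] at hx
      subst hx
      rw [← hcard, card_eq_zero, filter_eq_empty_iff]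
      intro k _ hk
      rw [← huniq] at hk
      exact not_adj_of_mem_distanceCell hx' hk hij (hammingGraph_adj_flip x k)
    · obtain ⟨x, hx⟩ := hP.nonempty j
      have hx' := hx
      rw [huniq] at hx
      subst hx
      rw [← hcard, card_eq_zero, filter_eq_empty_iff]
      intro k _ hk
      rw [← huniq] at hk
      exact not_adj_of_mem_distanceCell hk hx' hij (hammingGraph_adj_flip x k).symm
  have hS0 : S 0 1 = 13 ∧ S 1 0 = 1 := hS 0
  have hS1 : S 1 2 = 6 ∧ S 2 1 = 6 := hS 1
  have hS2 : S 2 3 = 1 ∧ S 3 2 = 9 := hS 2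
  have f02 := hfar 0 2 (by decide)
  have f03 := hfar 0 3 (by decide)
  have f13 := hfar 1 3 (by decide)
  have r0 := hrow 0
  have r1 := hrow 1
  have r2 := hrow 2
  have r3 := hrow 3
  simp only [Fin.sum_univ_four] at r0 r1 r2 r3
  -- The array gives the entries beside the diagonal, `hfar` the zeros farther out, and the row sums
  -- 13 the diagonal.
  have hSM : S = quotientMatrix := by
    ext i j
    fin_cases i <;> fin_cases j <;> simp [quotientMatrix] <;> omega
  refine ⟨c, fun x j => by rw [hcard, hSM], ?_⟩
  ext x
  change x ∈ D ↔ c x = 0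
  rw [← huniq]
  change _ ↔ x ∈ distanceCell (hammingGraph 13 2) D 0
  rw [distanceCell_zero]

namespace IsColoring

variable {c : Word → Fin 4}

lemma le_add_one (h : IsColoring c) (x : Word) (i : Fin 13) :
    (c x : ℕ) ≤ c (flip x i) + 1 := by
  have key : ∀ a b : Fin 4, quotientMatrix a b ≠ 0 → (a : ℕ) ≤ b + 1 := by decide
  exact key _ _ fun h0 => h.ne_of_eq_zero h0 i rfl

lemma le_walk_length (h : IsColoring c) {x z : Word} (p : (hammingGraph 13 2).Walk x z)
    (hz : c z = 0) : (c x : ℕ) ≤ p.length := by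
  induction p with
  | nil => simp [hz]
  | @cons u _ _ hadj p ih =>
    obtain ⟨i, rfl⟩ := exists_flip_of_adj hadj
    have := h.le_add_one u i
    have := ih hz
    rw [SimpleGraph.Walk.length_cons]
    omega

lemma exists_edist_le (h : IsColoring c) (n : ℕ) (x : Word) (hx : (c x : ℕ) = n) :
    ∃ z, c z = 0 ∧ (hammingGraph 13 2).edist x z ≤ n := by
  induction n generalizing x with
  | zero => exact ⟨x, Fin.ext hx, by simp⟩
  | succ n ih =>
    have key : ∀ a : Fin 4, (a : ℕ) = n + 1 → ∃ b : Fin 4, (b : ℕ) = n ∧ quotientMatrix a b ≠ 0 := by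
      intro a ha
      obtain rfl | rfl | rfl : n = 0 ∨ n = 1 ∨ n = 2 := by omega
      all_goals (revert a; decide)
    obtain ⟨b, hb, hne⟩ := key _ hx
    obtain ⟨i, hi⟩ := h.exists_flip hne
    obtain ⟨z, hz, hle⟩ := ih (flip x i) (by rw [hi, hb])
    refine ⟨z, hz, (SimpleGraph.edist_triangle (v := flip x i)).trans ?_⟩
    rw [SimpleGraph.edist_eq_one_iff_adj.2 (hammingGraph_adj_flip x i), add_comm]
    push_cast
    gcongr

/-- Along an edge the color drops by at most one, and from a nonzero color some edge drops it by
exactly one; so the color is the distance to the zero cell. -/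
lemma distanceCell_eq (h : IsColoring c) (i : Fin 4) :
    distanceCell (hammingGraph 13 2) {x | c x = 0} i = {x | c x = i} := by
  have key : ∀ x, (⨅ z ∈ {x | c x = 0}, (hammingGraph 13 2).edist x z) = ((c x : ℕ) : ℕ∞) := by
    intro x
    obtain ⟨z, hz, hle⟩ := h.exists_edist_le _ x rfl
    refine le_antisymm (iInf₂_le_of_le z hz hle) (le_iInf₂ fun w hw => ?_)
    exact le_iInf fun p => by exact_mod_cast h.le_walk_length p hw
  ext x
  change (⨅ z ∈ {x | c x = 0}, (hammingGraph 13 2).edist x z) = ((i : ℕ) : ℕ∞) ↔ c x = i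
  rw [key, Nat.cast_inj, Fin.val_inj]

/-- The zero cell of a coloring is a completely regular code. -/
lemma isCRCode (h : IsColoring c) :
    IsCRCode (hammingGraph 13 2) ![13, 6, 1] ![1, 6, 9] {x | c x = 0} := by
  classical
  have hsize := h.card_cells
  have h3 : ∃ x, c x = 3 := by
    have : ({x | c x = 3} : Finset Word).Nonempty := card_pos.1 (by omega)
    obtain ⟨x, hx⟩ := this
    exact ⟨x, by simpa using hx⟩
  have h2 : ∃ x, c x = 2 := by
    obtain ⟨x, hx⟩ := h3
    obtain ⟨i, hi⟩ := h.exists_flip (x := x) (j := 2) (by rw [hx]; decide)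
    exact ⟨_, hi⟩
  have h1 : ∃ x, c x = 1 := by
    obtain ⟨x, hx⟩ := h2
    obtain ⟨i, hi⟩ := h.exists_flip (x := x) (j := 1) (by rw [hx]; decide)
    exact ⟨_, hi⟩
  have h0 : ∃ x, c x = 0 := by
    obtain ⟨x, hx⟩ := h1
    obtain ⟨i, hi⟩ := h.exists_flip (x := x) (j := 0) (by rw [hx]; decide)
    exact ⟨_, hi⟩
  refine ⟨h0, quotientMatrix, ⟨?_, ?_, ?_, ?_⟩, ?_⟩
  · intro i
    rw [h.distanceCell_eq]
    fin_cases i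
    exacts [h0, h1, h2, h3]
  · intro i j hij
    simp only [h.distanceCell_eq]
    exact Set.disjoint_left.2 fun x hx hx' => hij (hx.symm.trans hx')
  · ext x
    simp [h.distanceCell_eq]
  · intro i j x hx
    rw [h.distanceCell_eq] at hx
    rw [h.distanceCell_eq, encard_neighborSet_inter, ← show c x = i from hx, ← h x j]
    rfl
  · decide

end IsColoring

/-! ### The example from the ternary Hamming code -/

/-- The points of the projective plane over the field of order 3, one vector for each. -/
def point : Fin 13 → Fin 3 → ZMod 3 :=
  ![![1, 0, 0], ![0, 1, 0], ![1, 1, 0], ![2, 1, 0], ![0, 0, 1], ![1, 0, 1], ![2, 0, 1],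
    ![0, 1, 1], ![1, 1, 1], ![2, 1, 1], ![0, 2, 1], ![1, 2, 1], ![2, 2, 1]]

/-- The symbols `0` and `1` as the nonzero elements of the field of order 3. -/
def sgn (a : Fin 2) : ZMod 3 := if a = 0 then 1 else -1

/-- The words that belong, as vectors over the field of order 3, to the ternary Hamming code of
length 13. -/
def hammingWords : Set Word := {x | ∀ k, ∑ i, sgn (x i) * point i k = 0}

/-! ### The distance partition of `hammingWords`

A word is encoded by the number with these binary digits, and a set of words by the number whose
binary digits are the values of its indicator function. -/

/-- The number whose binary digits are the symbols of `x`. -/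
def encode (x : Word) : ℕ := Nat.ofBits fun i => x i == 1

lemma encode_lt (x : Word) : encode x < 2 ^ 13 := Nat.ofBits_lt_two_pow _

lemma testBit_encode (x : Word) (i : Fin 13) : (encode x).testBit i = (x i == 1) :=
  Nat.testBit_ofBits_lt _ _ i.2

lemma encode_flip (x : Word) (i : Fin 13) : encode (flip x i) = encode x ^^^ 2 ^ (i : ℕ) := by
  refine Nat.eq_of_testBit_eq fun k => ?_
  rw [Nat.testBit_xor, Nat.testBit_two_pow]
  by_cases hk : k < 13
  · lift k to Fin 13 using hk
    rw [testBit_encode, testBit_encode]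
    by_cases hki : k = i
    · subst hki
      rw [flip_apply_self]
      have : ∀ a : Fin 2, (a + 1 == 1) = ((a == 1) ^^ true) := by decide
      simpa using this (x k)
    · rw [flip_apply_of_ne x hki]
      have : (i : ℕ) ≠ k := fun h => hki (Fin.ext h.symm)
      simp [this]
  · have : (i : ℕ) ≠ k := by omega
    rw [encode, encode, Nat.testBit_ofBits_ge _ _ (by omega), Nat.testBit_ofBits_ge _ _ (by omega)]
    simp [this]

/-- The value `f n`, written so that the evaluation of `f n` starts with the evaluation of `n`. -/
def force {α : Type*} (n : ℕ) (f : ℕ → α) : α :=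
  match n with
  | 0 => f 0
  | k + 1 => f k.succ

lemma force_eq {α : Type*} (n : ℕ) (f : ℕ → α) : force n f = f n := by
  cases n <;> rfl

/-- The `k`-th coordinate of `point i`. -/
def pointCoord (i k : ℕ) : ℕ :=
  (bif i == 0 then 1 else bif Nat.blt i 4 then i + 2 else i + 5) / 3 ^ k % 3

lemma pointCoord_eq : ∀ (i : Fin 13) (k : Fin 3), ((pointCoord i k : ℕ) : ZMod 3) = point i k := by
  decide

/-- The `k`-th coordinate of the syndrome of the word with code `n`, summed over the first `m`
positions. -/
def syndrome (n k : ℕ) : ℕ → ℕ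
  | 0 => 0
  | m + 1 => syndrome n k m + (bif n.testBit m then 2 else 1) * pointCoord m k

lemma syndrome_eq (n k m : ℕ) :
    syndrome n k m = ∑ i ∈ range m, (bif n.testBit i then 2 else 1) * pointCoord i k := by
  induction m with
  | zero => rfl
  | succ m ih => rw [syndrome, ih, sum_range_succ]

lemma syndrome_encode (x : Word) (k : Fin 3) :
    ((syndrome (encode x) k 13 : ℕ) : ZMod 3) = ∑ i, sgn (x i) * point i k := by
  rw [syndrome_eq, ← Fin.sum_univ_eq_sum_range
    (fun i => (bif (encode x).testBit i then 2 else 1) * pointCoord i k), Nat.cast_sum]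
  refine sum_congr rfl fun i _ => ?_
  rw [Nat.cast_mul, pointCoord_eq, testBit_encode]
  have : ∀ a : Fin 2, (((bif a == 1 then 2 else 1 : ℕ)) : ZMod 3) = sgn a := by decide
  rw [this]

/-- The code of the set of words with syndrome zero; `a`, `b`, `d` accumulate the syndrome. -/
def syndromeTable : ℕ → ℕ → ℕ → ℕ → ℕ
  | 0, a, b, d => bif a % 3 == 0 && (b % 3 == 0 && d % 3 == 0) then 1 else 0
  | k + 1, a, b, d =>
    let p := pointCoord k 0
    let q := pointCoord k 1
    let r := pointCoord k 2
    syndromeTable k ((a + p) % 3) ((b + q) % 3) ((d + r) % 3) |||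
      syndromeTable k ((a + 2 * p) % 3) ((b + 2 * q) % 3) ((d + 2 * r) % 3) <<< 2 ^ k

/-- The code of the set of the words whose `i`-th symbol is `0`. -/
def zeroMask (i : ℕ) : ℕ := (2 ^ 2 ^ 13 - 1) / (2 ^ 2 ^ i + 1)

/-- The code of the set of neighbors, along the first `m` positions, of the words of a set. -/
def neighborTable (S : ℕ) : ℕ → ℕ
  | 0 => 0
  | m + 1 => neighborTable S m |||
      ((S &&& zeroMask m) <<< 2 ^ m ||| ((S >>> 2 ^ m) &&& zeroMask m))

/-- The code of the set of the words with syndrome zero. -/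
def codeTable : ℕ := syndromeTable 13 0 0 0

/-- The code of the set of the neighbors of the words with syndrome zero. -/
def firstTable : ℕ := force codeTable fun S => neighborTable S 13

/-- The code of the set of the words at distance at least 2 from the words with syndrome zero. -/
def highTable : ℕ := (2 ^ 2 ^ 13 - 1) ^^^ (codeTable ||| firstTable)

/-- The code of the set of the words at distance 1 or 3 from the words with syndrome zero. -/
def oddTable : ℕ :=
  force firstTable fun T => T ||| (highTable &&& ((2 ^ 2 ^ 13 - 1) ^^^ neighborTable T 13))

/-- The cell of the word with code `n`, where `O` and `H` are the codes of the union of the cells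
1 and 3 and of the union of the cells 2 and 3. -/
def cellOf (O H n : ℕ) : ℕ := (O >>> n) % 2 + 2 * ((H >>> n) % 2)

lemma cellOf_lt (O H n : ℕ) : cellOf O H n < 4 := by
  unfold cellOf
  omega

/-- The number with the base 16 digits `a j`, where `a j` is the number of neighbors, along the
first `m` positions, of the word with code `n` that are in the cell `j`. -/
def neighborCode (O H n : ℕ) : ℕ → ℕ
  | 0 => 0
  | m + 1 => neighborCode O H n m + 16 ^ cellOf O H (n ^^^ 2 ^ m)

lemma neighborCode_eq (O H n m : ℕ) :
    neighborCode O H n m = ∑ i ∈ range m, 16 ^ cellOf O H (n ^^^ 2 ^ i) := by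
  induction m with
  | zero => rfl
  | succ m ih => rw [neighborCode, ih, sum_range_succ]

/-- The number whose base 16 digits are the entries of a row of `quotientMatrix`. -/
def rowCode (a : ℕ) : ℕ :=
  bif a == 0 then 208 else bif a == 1 then 1633 else bif a == 2 then 5728 else 18688

/-- The test that the word with code `n` has the right numbers of neighbors, and is in the cell `0`
if its syndrome is zero. -/
def checkWord (O H n : ℕ) : Bool :=
  (neighborCode O H n 13 == rowCode (cellOf O H n)) && (cellOf O H n == 0 ||
    !(syndrome n 0 13 % 3 == 0 && (syndrome n 1 13 % 3 == 0 && syndrome n 2 13 % 3 == 0)))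

/-- The conjunction of `p n` for `m * 2 ^ k ≤ n < (m + 1) * 2 ^ k`. -/
def allBits (p : ℕ → Bool) : ℕ → ℕ → Bool
  | 0, m => force m p
  | k + 1, m => allBits p k (2 * m) && allBits p k (2 * m + 1)

lemma allBits_spec {p : ℕ → Bool} {k m : ℕ} (h : allBits p k m = true) {n : ℕ} (hn : n < 2 ^ k) :
    p (m * 2 ^ k + n) = true := by
  induction k generalizing m n with
  | zero =>
    obtain rfl : n = 0 := by omega
    simpa [allBits, force_eq] using h
  | succ k ih =>
    rw [allBits, Bool.and_eq_true] at h
    rw [pow_succ] at hn ⊢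
    by_cases hlt : n < 2 ^ k
    · have := ih h.1 hlt
      rwa [show 2 * m * 2 ^ k + n = m * (2 ^ k * 2) + n by ring] at this
    · have := ih h.2 (n := n - 2 ^ k) (by omega)
      rwa [show (2 * m + 1) * 2 ^ k + (n - 2 ^ k) = m * (2 ^ k * 2) + (2 ^ k + (n - 2 ^ k)) by ring,
        Nat.add_sub_cancel' (not_lt.1 hlt)] at this

/-- The only computation over all 8192 words. The tables need no correctness proof: whatever sets
they encode, passing this check gives the neighbor counts and the color of the Hamming words. -/
lemma allBits_checkWord : force oddTable (fun O => force highTable fun H =>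
    allBits (checkWord O H) 13 0) = true := by
  decide +kernel

lemma checkWord_encode (x : Word) : checkWord oddTable highTable (encode x) = true := by
  have h := allBits_checkWord
  rw [force_eq, force_eq] at h
  simpa using allBits_spec h (encode_lt x)

/-- The distance from `hammingWords`. -/
def hammingWordsCell (x : Word) : Fin 4 :=
  ⟨cellOf oddTable highTable (encode x), cellOf_lt _ _ _⟩

lemma coe_hammingWordsCell (x : Word) :
    (hammingWordsCell x : ℕ) = cellOf oddTable highTable (encode x) := rfl

lemma sum_sixteen_pow {ι : Type*} (s : Finset ι) (f : ι → Fin 4) :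
    ∑ i ∈ s, 16 ^ (f i : ℕ) = ∑ j : Fin 4, #{i ∈ s | f i = j} * 16 ^ (j : ℕ) := by
  rw [← sum_fiberwise s f]
  refine sum_congr rfl fun j _ => ?_
  rw [← smul_eq_mul, ← sum_const]
  refine sum_congr rfl fun i hi => ?_
  rw [(mem_filter.1 hi).2]

/-- Counts are at most 13, hence genuine base 16 digits, and one number determines all four. -/
lemma eq_quotientMatrix_of_code {n : Fin 4 → ℕ} (hn : ∀ k, n k ≤ 13) (a : Fin 4)
    (h : ∑ j : Fin 4, n j * 16 ^ (j : ℕ) = rowCode a) (j : Fin 4) : n j = quotientMatrix a j := by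
  have h0 := hn 0
  have h1 := hn 1
  have h2 := hn 2
  have h3 := hn 3
  rw [Fin.sum_univ_four] at h
  fin_cases a <;> fin_cases j <;> simp [rowCode, quotientMatrix] at h ⊢ <;> omega

lemma isColoring_hammingWordsCell : IsColoring hammingWordsCell := by
  intro x j
  have h := checkWord_encode x
  simp only [checkWord, Bool.and_eq_true, beq_iff_eq] at h
  have h1 := h.1
  rw [neighborCode_eq, ← Fin.sum_univ_eq_sum_range
    (fun i => 16 ^ cellOf oddTable highTable (encode x ^^^ 2 ^ i))] at h1
  have h2 : ∀ i : Fin 13, cellOf oddTable highTable (encode x ^^^ 2 ^ (i : ℕ)) =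
      (hammingWordsCell (flip x i) : ℕ) := fun i => by rw [coe_hammingWordsCell, encode_flip]
  simp only [h2, sum_sixteen_pow, ← coe_hammingWordsCell] at h1
  exact eq_quotientMatrix_of_code (n := fun k => #{i | hammingWordsCell (flip x i) = k})
    (fun k => (card_le_univ _).trans (by simp)) _ h1 j

/-- This inclusion suffices; the final cardinality comparison makes the converse unnecessary. -/
lemma hammingWordsCell_eq_zero {x : Word} (hx : x ∈ hammingWords) : hammingWordsCell x = 0 := by
  have h := checkWord_encode x
  have hs : ∀ k : Fin 3, syndrome (encode x) k 13 % 3 = 0 := fun k => by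
    rw [← Nat.dvd_iff_mod_eq_zero, ← ZMod.natCast_eq_zero_iff, syndrome_encode]
    exact hx k
  have h0 := hs 0
  have h1 := hs 1
  have h2 := hs 2
  simp only [Fin.val_zero, Fin.val_one, Fin.val_two] at h0 h1 h2
  simp only [checkWord, Bool.and_eq_true, h0, h1, h2] at h
  simpa [hammingWordsCell, Fin.ext_iff] using h.2

/-! ### Subcubes as ternary words, and the distance to a subcube -/

lemma sgn_ne_zero (a : Fin 2) : sgn a ≠ 0 := by decide +revert

lemma sgn_add_one (a : Fin 2) : sgn (a + 1) = -sgn a := by decide +revert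

lemma sgn_injective : Function.Injective sgn := by decide

lemma exists_sgn_eq {t : ZMod 3} (ht : t ≠ 0) : ∃ a, sgn a = t := by decide +revert

/-- A ternary word `t` represents a subcube: `x` agrees with `t` if `x` is in this subcube. -/
def Agrees (t : Fin 13 → ZMod 3) (x : Word) : Prop := ∀ i, t i ≠ 0 → sgn (x i) = t i

instance (t : Fin 13 → ZMod 3) (x : Word) : Decidable (Agrees t x) :=
  inferInstanceAs (Decidable (∀ i, t i ≠ 0 → sgn (x i) = t i))

/-- The distance from `x` to the subcube represented by `t`. -/
def dis (t : Fin 13 → ZMod 3) (x : Word) : ℕ := #{i | t i ≠ 0 ∧ sgn (x i) ≠ t i}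

lemma dis_eq_zero {t : Fin 13 → ZMod 3} {x : Word} : dis t x = 0 ↔ Agrees t x := by
  rw [dis, card_eq_zero, filter_eq_empty_iff]
  simp [Agrees]

lemma exists_agrees (t : Fin 13 → ZMod 3) : ∃ x, Agrees t x := by
  have : ∀ i, ∃ a, t i ≠ 0 → sgn a = t i := fun i => by
    by_cases hi : t i = 0
    · exact ⟨0, fun h => absurd hi h⟩
    · obtain ⟨a, ha⟩ := exists_sgn_eq hi
      exact ⟨a, fun _ => ha⟩
  choose x hx using this
  exact ⟨x, hx⟩

lemma card_eq_zero_of_weight {t : Fin 13 → ZMod 3} (ht : #{i | t i ≠ 0} = 9) :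
    #{i | t i = 0} = 4 := by
  have := card_filter_add_card_filter_not (s := (univ : Finset (Fin 13))) (fun i => t i = 0)
  simp only [card_univ, Fintype.card_fin] at this
  simp only [Ne] at ht
  omega

lemma card_agrees {t : Fin 13 → ZMod 3} (ht : #{i | t i ≠ 0} = 9) : #{x | Agrees t x} = 16 := by
  have : ({x | Agrees t x} : Finset Word) =
      Fintype.piFinset fun i => {a | t i ≠ 0 → sgn a = t i} := by
    ext x
    rw [mem_filter, Fintype.mem_piFinset]
    simp [Agrees]
  rw [this, Fintype.card_piFinset]
  have key : ∀ s : ZMod 3, #{a | s ≠ 0 → sgn a = s} = if s = 0 then 2 else 1 := by decide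
  simp only [key]
  rw [prod_ite, prod_const, prod_const_one, mul_one, card_eq_zero_of_weight ht]
  rfl

section flip

variable (t : Fin 13 → ZMod 3) (x : Word) (i : Fin 13)

lemma dis_eq_add_sum : dis t x = (if t i ≠ 0 ∧ sgn (x i) ≠ t i then 1 else 0) +
    ∑ j ∈ univ.erase i, if t j ≠ 0 ∧ sgn (x j) ≠ t j then 1 else 0 := by
  rw [dis, card_filter]
  exact (add_sum_erase univ (fun j => if t j ≠ 0 ∧ sgn (x j) ≠ t j then 1 else 0)
    (mem_univ i)).symm

lemma dis_flip_add : dis t (flip x i) + (if t i ≠ 0 ∧ sgn (x i) ≠ t i then 1 else 0) =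
    dis t x + (if t i ≠ 0 ∧ sgn (x i) = t i then 1 else 0) := by
  rw [dis_eq_add_sum t (flip x i) i, dis_eq_add_sum t x i]
  have h1 : ∑ j ∈ univ.erase i, (if t j ≠ 0 ∧ sgn (flip x i j) ≠ t j then 1 else 0) =
      ∑ j ∈ univ.erase i, if t j ≠ 0 ∧ sgn (x j) ≠ t j then 1 else 0 :=
    sum_congr rfl fun j hj => by rw [flip_apply_of_ne x (ne_of_mem_erase hj)]
  have h2 : ∀ (s : ZMod 3) (a : Fin 2), (if s ≠ 0 ∧ sgn (a + 1) ≠ s then 1 else 0) =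
      if s ≠ 0 ∧ sgn a = s then 1 else 0 := by decide
  rw [h1, flip_apply_self, h2]
  ring

end flip

lemma dis_add_card_agree (t : Fin 13 → ZMod 3) (x : Word) :
    dis t x + #{i | t i ≠ 0 ∧ sgn (x i) = t i} = #{i | t i ≠ 0} := by
  have := card_filter_add_card_filter_not (s := ({i | t i ≠ 0} : Finset (Fin 13)))
    (fun i => sgn (x i) = t i)
  simp only [filter_filter] at this
  simp only [dis, Ne] at this ⊢
  omega

lemma dis_le {t : Fin 13 → ZMod 3} (ht : #{i | t i ≠ 0} = 9) (x : Word) : dis t x ≤ 9 := by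
  have := dis_add_card_agree t x
  omega

/-- The 4 free coordinates keep the distance, the agreeing fixed ones raise it and the disagreeing
ones lower it. -/
lemma sum_flip_dis {t : Fin 13 → ZMod 3} (ht : #{i | t i ≠ 0} = 9) (x : Word) (d : ℕ) :
    ∑ i, (if dis t (flip x i) = d then 1 else 0) = (if dis t x = d then 4 else 0) +
      (if dis t x + 1 = d then 9 - dis t x else 0) + (if dis t x = d + 1 then dis t x else 0) := by
  have key : ∀ i, (if dis t (flip x i) = d then 1 else 0) =
      (if t i = 0 then 1 else 0) * (if dis t x = d then 1 else 0) +
      (if t i ≠ 0 ∧ sgn (x i) = t i then 1 else 0) * (if dis t x + 1 = d then 1 else 0) +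
      (if t i ≠ 0 ∧ sgn (x i) ≠ t i then 1 else 0) * (if dis t x = d + 1 then 1 else 0) := by
    intro i
    have := dis_flip_add t x i
    by_cases h0 : t i = 0
    · simp_all
    · by_cases h1 : sgn (x i) = t i
      · simp_all
      · have h2 : dis t x = dis t (flip x i) + 1 := by simp_all
        simp [h0, h1, h2]
  have h1 := dis_add_card_agree t x
  simp only [key, sum_add_distrib, ← sum_mul, ← card_filter]
  rw [card_eq_zero_of_weight ht, show #{i | t i ≠ 0 ∧ sgn (x i) = t i} = 9 - dis t x by omega]
  rw [dis]
  simp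

/-- The linear recurrence for the sizes of the intersections of the cells of a coloring with the
sets of words at a given distance from a subcube determines these sizes. -/
lemma shell_solution {N : ℕ → Fin 4 → ℕ} (h0 : N 0 = ![0, 0, 0, 16])
    (h1 : ∀ j, ∑ k, N 0 k * quotientMatrix k j = 4 * N 0 j + N 1 j)
    (h2 : ∀ d j, ∑ k, N (d + 1) k * quotientMatrix k j =
      4 * N (d + 1) j + (9 - d) * N d j + (d + 2) * N (d + 2) j) :
    (∀ d ≤ 9, N d 0 ≠ 0 → d = 3 ∨ d = 6) ∧ (N 1 3 = 0 ∧ N 2 3 = 0) ∧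
      N 9 0 = 0 ∧ N 9 1 = 0 ∧ N 9 2 = 0 := by
  have e0 : N 0 0 = 0 ∧ N 0 1 = 0 ∧ N 0 2 = 0 ∧ N 0 3 = 16 := by simp [h0]
  have step : ∀ d, _ ∧ _ ∧ _ ∧ _ := fun d => ⟨h2 d 0, h2 d 1, h2 d 2, h2 d 3⟩
  have s1 : _ ∧ _ ∧ _ ∧ _ := ⟨h1 0, h1 1, h1 2, h1 3⟩
  simp only [Fin.sum_univ_four, quotientMatrix, Fin.isValue, Matrix.cons_val] at s1 step
  have e1 : N 1 0 = 0 ∧ N 1 1 = 0 ∧ N 1 2 = 144 ∧ N 1 3 = 0 := by omega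
  have e2 : N 2 0 = 0 ∧ N 2 1 = 432 ∧ N 2 2 = 144 ∧ N 2 3 = 0 := by
    have := step 0
    norm_num at this
    omega
  have e3 : N 3 0 = 144 ∧ N 3 1 = 576 ∧ N 3 2 = 576 ∧ N 3 3 = 48 := by
    have := step 1
    norm_num at this
    omega
  have e4 : N 4 0 = 0 ∧ N 4 1 = 864 ∧ N 4 2 = 1008 ∧ N 4 3 = 144 := by
    have := step 2
    norm_num at this
    omega
  have e5 : N 5 0 = 0 ∧ N 5 1 = 864 ∧ N 5 2 = 1008 ∧ N 5 3 = 144 := by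
    have := step 3
    norm_num at this
    omega
  have e6 : N 6 0 = 144 ∧ N 6 1 = 576 ∧ N 6 2 = 576 ∧ N 6 3 = 48 := by
    have := step 4
    norm_num at this
    omega
  have e7 : N 7 0 = 0 ∧ N 7 1 = 432 ∧ N 7 2 = 144 ∧ N 7 3 = 0 := by
    have := step 5
    norm_num at this
    omega
  have e8 : N 8 0 = 0 ∧ N 8 1 = 0 ∧ N 8 2 = 144 ∧ N 8 3 = 0 := by
    have := step 6
    norm_num at this
    omega
  have e9 : N 9 0 = 0 ∧ N 9 1 = 0 ∧ N 9 2 = 0 ∧ N 9 3 = 16 := by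
    have := step 7
    norm_num at this
    omega
  refine ⟨fun d hd hne => ?_, by omega, by omega⟩
  interval_cases d <;> omega

/-! ### The last cell is a union of subcubes -/

/-- The ternary word of a subcube of codimension 9 that lies in the last cell. -/
def IsCube (c : Word → Fin 4) (t : Fin 13 → ZMod 3) : Prop :=
  #{i | t i ≠ 0} = 9 ∧ ∀ x, Agrees t x → c x = 3

/-- The ternary word of the subcube of the last cell that contains `y`. -/
def cubeWord (c : Word → Fin 4) (y : Word) (i : Fin 13) : ZMod 3 :=
  if c (flip y i) = 3 then 0 else sgn (y i)

lemma cubeWord_eq_zero {c : Word → Fin 4} {y : Word} {i : Fin 13} :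
    cubeWord c y i = 0 ↔ c (flip y i) = 3 := by
  simp [cubeWord, sgn_ne_zero]

lemma agrees_cubeWord (c : Word → Fin 4) (y : Word) : Agrees (cubeWord c y) y := by
  intro i hi
  rw [Ne, cubeWord_eq_zero] at hi
  simp [cubeWord, hi]

namespace IsColoring

variable {c : Word → Fin 4}

lemma flip_flip_of_three (h : IsColoring c) {y : Word} {i j : Fin 13} (hi : c (flip y i) = 3)
    (hj : c (flip y j) = 3) (hij : i ≠ j) : c (flip (flip y i) j) = 3 := by
  refine (h.flip_of_three hi j).resolve_left fun h2 => ?_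
  -- Were the fourth corner of the square in cell 2, it would have two neighbors in cell 3, along
  -- `i` and along `j`.
  have hcard : #{k | c (flip (flip (flip y i) j) k) = 3} = 1 := by
    rw [h, h2]
    rfl
  obtain ⟨a, ha⟩ := card_eq_one.1 hcard
  have hja : j ∈ ({k | c (flip (flip (flip y i) j) k) = 3} : Finset _) := by
    simp [flip_flip, hi]
  have hia : i ∈ ({k | c (flip (flip (flip y i) j) k) = 3} : Finset _) := by
    simp [flip_comm y i j, flip_flip, hj]
  rw [ha, mem_singleton] at hja hia
  exact hij (hia.trans hja.symm)

/-- The directions that stay in the last cell do not change when one moves along such a direction;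
so they span a subcube. -/
lemma flip_flip_eq_three_iff (h : IsColoring c) {y : Word} (hy : c y = 3) {i : Fin 13}
    (hi : c (flip y i) = 3) (j : Fin 13) : c (flip (flip y i) j) = 3 ↔ c (flip y j) = 3 := by
  by_cases hij : i = j
  · subst hij
    simp [flip_flip, hy, hi]
  refine ⟨fun hj => ?_, fun hj => h.flip_flip_of_three hi hj hij⟩
  have := h.flip_flip_of_three (y := flip y i) (i := j) (j := i) hj (by rwa [flip_flip])
    (Ne.symm hij)
  rwa [flip_comm y i j, flip_flip] at this

lemma eq_three_of_stars (h : IsColoring c) (x : Word) (n : ℕ) : ∀ y, c y = 3 →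
    #{i | x i ≠ y i} = n → (∀ i, x i ≠ y i → c (flip y i) = 3) → c x = 3 := by
  induction n with
  | zero =>
    intro y hy hn _
    rw [card_eq_zero, filter_eq_empty_iff] at hn
    have : x = y := funext fun i => not_not.1 (hn (mem_univ i))
    rwa [this]
  | succ n ih =>
    intro y hy hn hs
    obtain ⟨i, hi⟩ := card_pos.1 (by rw [hn]; exact n.succ_pos)
    have hi' := (mem_filter.1 hi).2
    have hiff : ∀ j, x j ≠ flip y i j ↔ x j ≠ y j ∧ j ≠ i := fun j => by
      by_cases hj : j = i
      · subst hj
        simp [flip_apply_self, fin_two_eq_add_one hi']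
      · simp [flip_apply_of_ne y hj, hj]
    refine ih (flip y i) (hs i hi') ?_ fun j hj => ?_
    · have : ({j | x j ≠ flip y i j} : Finset (Fin 13)) = ({j | x j ≠ y j} : Finset _).erase i := by
        ext j
        simp only [mem_filter, mem_univ, true_and, mem_erase, hiff]
        tauto
      rw [this, card_erase_of_mem hi, hn]
      rfl
    · rw [h.flip_flip_eq_three_iff hy (hs i hi')]
      exact hs j ((hiff j).1 hj).1

lemma isCube_cubeWord (h : IsColoring c) {y : Word} (hy : c y = 3) : IsCube c (cubeWord c y) := by
  constructor
  · have h4 : #{i | c (flip y i) = 3} = 4 := by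
      rw [h, hy]
      rfl
    have := card_filter_add_card_filter_not (s := (univ : Finset (Fin 13)))
      (fun i => c (flip y i) = 3)
    simp only [card_univ, Fintype.card_fin] at this
    simp only [Ne, cubeWord_eq_zero]
    omega
  · intro x hx
    refine h.eq_three_of_stars x _ y hy rfl fun i hi => ?_
    by_contra hne
    have := hx i (mt cubeWord_eq_zero.1 hne)
    rw [cubeWord, if_neg hne] at this
    exact hi (sgn_injective this)

lemma cubeWord_eq (h : IsColoring c) {t : Fin 13 → ZMod 3} (ht : IsCube c t) {y : Word}
    (hy : Agrees t y) : cubeWord c y = t := by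
  have hsub : ({i | t i = 0} : Finset (Fin 13)) ⊆
      ({i | cubeWord c y i = 0} : Finset (Fin 13)) := by
    intro i hi
    simp only [mem_filter, mem_univ, true_and, cubeWord_eq_zero] at hi ⊢
    refine ht.2 _ fun j hj => ?_
    have hji : j ≠ i := by
      rintro rfl
      exact hj hi
    rw [flip_apply_of_ne y hji]
    exact hy j hj
  have heq := eq_of_subset_of_card_le hsub (by
    rw [card_eq_zero_of_weight ht.1, card_eq_zero_of_weight (h.isCube_cubeWord (ht.2 y hy)).1])
  funext i
  have hi : t i = 0 ↔ cubeWord c y i = 0 := by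
    have := congrArg (i ∈ ·) heq
    simpa using this
  by_cases h0 : t i = 0
  · rw [h0, hi.1 h0]
  · rw [← hy i h0, agrees_cubeWord c y i (mt hi.2 h0)]

lemma card_cubeWord_eq (h : IsColoring c) {t : Fin 13 → ZMod 3} (ht : IsCube c t) :
    #{y | c y = 3 ∧ cubeWord c y = t} = 16 := by
  rw [← card_agrees ht.1]
  congr 1
  ext y
  simp only [mem_filter, mem_univ, true_and]
  refine ⟨?_, fun hy => ⟨ht.2 y hy, h.cubeWord_eq ht hy⟩⟩
  rintro ⟨-, rfl⟩
  exact agrees_cubeWord c y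

/-- Double count of the edges between the shell at distance `d` and the cell `j`. The middle term is
the contribution of shell `d - 1`, written as a sum so that `d = 0` needs no separate statement. -/
lemma shell_recurrence (h : IsColoring c) {t : Fin 13 → ZMod 3} (ht : #{i | t i ≠ 0} = 9) (d : ℕ)
    (j : Fin 4) : ∑ k, #{x | dis t x = d ∧ c x = k} * quotientMatrix k j =
      4 * #{x | dis t x = d ∧ c x = j} +
      ∑ x, (if dis t x + 1 = d ∧ c x = j then 9 - dis t x else 0) +
      (d + 1) * #{x | dis t x = d + 1 ∧ c x = j} := by
  have h1 := sum_mul_sum_flip (fun x => if dis t x = d then 1 else 0)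
    (fun x => if c x = j then 1 else 0)
  simp only [h.sum_flip, sum_flip_dis ht] at h1
  have h2 : ∑ k, #{x | dis t x = d ∧ c x = k} * quotientMatrix k j =
      ∑ x, (if dis t x = d then 1 else 0) * quotientMatrix (c x) j := by
    simp only [card_filter, sum_mul]
    rw [sum_comm]
    refine sum_congr rfl fun x _ => ?_
    rw [sum_eq_single (c x)]
    · simp
    · intro k _ hk
      simp [hk.symm]
    · simp
  rw [h2, h1]
  simp only [card_filter, mul_sum, ← sum_add_distrib]
  refine sum_congr rfl fun x _ => ?_
  by_cases hj : c x = j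
  · simp only [hj, if_true, one_mul, and_true, mul_ite, mul_one, mul_zero]
    by_cases hd : dis t x = d + 1 <;> simp [hd]
  · simp [hj]

lemma shell (h : IsColoring c) {t : Fin 13 → ZMod 3} (ht : IsCube c t) :
    (∀ z, c z = 0 → dis t z = 3 ∨ dis t z = 6) ∧
    (∀ y, c y = 3 → dis t y ≠ 1 ∧ dis t y ≠ 2) ∧ ∀ y, dis t y = 9 → c y = 3 := by
  have sol := shell_solution (N := fun d j => #{x | dis t x = d ∧ c x = j}) ?_ ?_ ?_
  · obtain ⟨s1, ⟨s2, s3⟩, s4, s5, s6⟩ := sol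
    simp only [card_eq_zero, filter_eq_empty_iff] at s2 s3 s4 s5 s6
    refine ⟨fun z hz => s1 _ (dis_le ht.1 z) ?_, fun y hy => ⟨?_, ?_⟩, fun y hy => ?_⟩
    · exact card_ne_zero.2 ⟨z, by simp [hz]⟩
    · exact fun hd => s2 (mem_univ y) ⟨hd, hy⟩
    · exact fun hd => s3 (mem_univ y) ⟨hd, hy⟩
    · have n0 : c y ≠ 0 := fun hc => s4 (mem_univ y) ⟨hy, hc⟩
      have n1 : c y ≠ 1 := fun hc => s5 (mem_univ y) ⟨hy, hc⟩
      have n2 : c y ≠ 2 := fun hc => s6 (mem_univ y) ⟨hy, hc⟩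
      generalize c y = a at *
      decide +revert
  · funext j
    have hcell : ∀ x, Agrees t x ∧ c x = j ↔ Agrees t x ∧ 3 = j := fun x =>
      and_congr_right fun hx => by rw [ht.2 x hx]
    simp only [dis_eq_zero, hcell]
    have := card_agrees ht.1
    fin_cases j <;> simp [this]
  · intro j
    have := h.shell_recurrence ht.1 0 j
    simpa using this
  · intro d j
    have := h.shell_recurrence ht.1 (d + 1) j
    have hsum : ∑ x, (if dis t x + 1 = d + 1 ∧ c x = j then 9 - dis t x else 0) =
        (9 - d) * #{x | dis t x = d ∧ c x = j} := by
      rw [card_filter, mul_sum]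
      refine sum_congr rfl fun x _ => ?_
      by_cases hd : dis t x = d <;> simp [hd]
    rw [this, hsum]

end IsColoring

/-! ### Orthogonality modulo 3, overlaps and conflicts -/

/-- Agreements minus disagreements is the weight minus twice the distance, and -2 = 1 modulo 3. -/
lemma sum_mul_sgn (t : Fin 13 → ZMod 3) (x : Word) :
    ∑ i, t i * sgn (x i) = (#{i | t i ≠ 0} : ZMod 3) + (dis t x : ZMod 3) := by
  have key : ∀ (s : ZMod 3) (a : Fin 2), s * sgn a =
      ((if s ≠ 0 then 1 else 0 : ℕ) : ZMod 3) +
        ((if s ≠ 0 ∧ sgn a ≠ s then 1 else 0 : ℕ) : ZMod 3) := by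
    decide
  rw [dis, card_filter, card_filter, Nat.cast_sum, Nat.cast_sum, ← sum_add_distrib]
  exact sum_congr rfl fun i _ => key _ _

lemma sum_mul_sgn_eq_zero_iff {t : Fin 13 → ZMod 3} (ht : #{i | t i ≠ 0} = 9) (x : Word) :
    ∑ i, t i * sgn (x i) = 0 ↔ 3 ∣ dis t x := by
  rw [sum_mul_sgn, ht, show ((9 : ℕ) : ZMod 3) = 0 from rfl, zero_add, ZMod.natCast_eq_zero_iff]

lemma weight_neg (t : Fin 13 → ZMod 3) : #{i | (-t) i ≠ 0} = #{i | t i ≠ 0} := by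
  simp

lemma dis_of_agrees_neg {t : Fin 13 → ZMod 3} {x : Word} (hx : Agrees (-t) x) :
    dis t x = #{i | t i ≠ 0} := by
  rw [dis]
  congr 1
  ext i
  have key : ∀ s u : ZMod 3, s ≠ 0 → u = -s → u ≠ s := by decide
  simp only [mem_filter, mem_univ, true_and, and_iff_left_iff_imp]
  exact fun hi => key _ _ hi (hx i (by simpa using hi))

/-- The number of positions where both `t` and `s` are nonzero. -/
def overlap (t s : Fin 13 → ZMod 3) : ℕ := #{i | t i ≠ 0 ∧ s i ≠ 0}

/-- The number of positions where `t` and `s` are nonzero and different. -/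
def conflict (t s : Fin 13 → ZMod 3) : ℕ := #{i | t i ≠ 0 ∧ s i ≠ 0 ∧ t i ≠ s i}

lemma conflict_add_conflict_neg (t s : Fin 13 → ZMod 3) :
    conflict t s + conflict t (-s) = overlap t s := by
  have key : ∀ a b : ZMod 3, (if a ≠ 0 ∧ b ≠ 0 ∧ a ≠ b then 1 else 0) +
      (if a ≠ 0 ∧ -b ≠ 0 ∧ a ≠ -b then 1 else 0) = if a ≠ 0 ∧ b ≠ 0 then 1 else 0 := by decide
  simp only [conflict, overlap, card_filter, ← sum_add_distrib]
  exact sum_congr rfl fun i _ => key _ _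

lemma weight_add (t s : Fin 13 → ZMod 3) :
    #{i | (t + s) i ≠ 0} + overlap t s + conflict t s = #{i | t i ≠ 0} + #{i | s i ≠ 0} := by
  have key : ∀ a b : ZMod 3, (if a + b ≠ 0 then 1 else 0) + (if a ≠ 0 ∧ b ≠ 0 then 1 else 0) +
      (if a ≠ 0 ∧ b ≠ 0 ∧ a ≠ b then 1 else 0) = (if a ≠ 0 then 1 else 0) +
        if b ≠ 0 then 1 else 0 := by decide
  simp only [conflict, overlap, card_filter, ← sum_add_distrib]
  exact sum_congr rfl fun i _ => key _ _

lemma card_common_zeros (t s : Fin 13 → ZMod 3) :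
    #{i | t i = 0 ∧ s i = 0} + #{i | t i ≠ 0} + #{i | s i ≠ 0} = 13 + overlap t s := by
  have key : ∀ a b : ZMod 3, (if a = 0 ∧ b = 0 then 1 else 0) + (if a ≠ 0 then 1 else 0) +
      (if b ≠ 0 then 1 else 0) = 1 + if a ≠ 0 ∧ b ≠ 0 then 1 else 0 := by decide
  have hsum := Fintype.sum_congr _ _ fun i => key (t i) (s i)
  simp only [sum_add_distrib, ← card_filter] at hsum
  simpa [overlap] using hsum

/-- The witness copies `t` on the free coordinates of `s`: the point of one subcube nearest to the
other. -/
lemma exists_agrees_dis_eq_conflict (t s : Fin 13 → ZMod 3) :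
    ∃ y, Agrees s y ∧ dis t y = conflict t s := by
  obtain ⟨y, hy⟩ := exists_agrees fun i => if s i ≠ 0 then s i else t i
  refine ⟨y, fun i hi => ?_, ?_⟩
  · have := hy i
    simp only [if_pos hi] at this
    exact this hi
  · rw [dis, conflict]
    congr 1
    ext i
    have := hy i
    simp only [mem_filter, mem_univ, true_and]
    refine and_congr_right fun ht => ?_
    by_cases hs : s i = 0
    · simp only [hs, ne_eq, not_true_eq_false, if_false] at this
      simp [hs, this ht]
    · simp only [ne_eq, hs, not_false_eq_true, if_true, true_implies] at this
      simp [hs, this, eq_comm]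

/-- Summation over the walks of length 3 in `H(13,2)` with a given first direction is symmetric. -/
lemma sum_mul_sum_flip_flip (F G : Word → ℕ) (i : Fin 13) :
    ∑ x, F x * ∑ j, ∑ k, G (flip (flip (flip x i) j) k) =
      ∑ x, G x * ∑ j, ∑ k, F (flip (flip (flip x i) j) k) := by
  have key : ∀ F G : Word → ℕ, ∑ x, F x * ∑ j, ∑ k, G (flip (flip (flip x i) j) k) =
      ∑ j, ∑ k, ∑ x, F x * G (flip (flip (flip x i) j) k) := by
    intro F G
    simp only [mul_sum]
    rw [sum_comm]
    exact sum_congr rfl fun j _ => sum_comm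
  rw [key, key]
  refine sum_congr rfl fun j _ => sum_congr rfl fun k _ => ?_
  refine Fintype.sum_equiv
    (Equiv.addRight (Pi.single i 1 + Pi.single j 1 + Pi.single k 1 : Word)) _ _ fun x => ?_
  have h1 : ∀ y, flip (flip (flip y i) j) k =
      y + (Pi.single i 1 + Pi.single j 1 + Pi.single k 1 : Word) := fun y => by
    simp only [flip, add_assoc]
  simp only [h1, Equiv.coe_addRight]
  rw [add_assoc x, word_add_self, add_zero, mul_comm]

/-! ### Double counting in the last cell: two supports overlap in 6 positions -/

namespace IsColoring

variable {c : Word → Fin 4}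

lemma sum_comp_flip (h : IsColoring c) (φ : Fin 4 → ℕ) (x : Word) :
    ∑ i, φ (c (flip x i)) = ∑ k, quotientMatrix (c x) k * φ k := by
  rw [← sum_fiberwise univ (fun i => c (flip x i))]
  refine sum_congr rfl fun k _ => ?_
  rw [← h x k, ← smul_eq_mul, ← sum_const]
  refine sum_congr rfl fun i hi => ?_
  rw [(mem_filter.1 hi).2]

/-- Count walks of length 3 with first direction `i` between cells 0 and 3. Each code word starts
6·1 of them; from the other end, a vertex of cell 3 starts 6·1 if the first step leaves cell 3, and
none otherwise. -/
lemma card_three_flip_ne (h : IsColoring c) (i : Fin 13) :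
    #{y | c y = 3 ∧ c (flip y i) ≠ 3} = 288 := by
  have hsum := sum_mul_sum_flip_flip (fun x => if c x = 0 then 1 else 0)
    (fun x => if c x = 3 then 1 else 0) i
  simp only [h.sum_flip] at hsum
  simp only [fun b x => h.sum_comp_flip (fun a => quotientMatrix a b) x] at hsum
  have h0 : ∀ x, (if c x = 0 then 1 else 0) *
      ∑ k, quotientMatrix (c (flip x i)) k * quotientMatrix k 3 = 6 * if c x = 0 then 1 else 0 := by
    intro x
    split_ifs with hx
    · rw [h.flip_of_zero hx i]
      rfl
    · simp
  have h3 : ∀ x, (if c x = 3 then 1 else 0) *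
      ∑ k, quotientMatrix (c (flip x i)) k * quotientMatrix k 0 =
        6 * if c x = 3 ∧ c (flip x i) ≠ 3 then 1 else 0 := by
    intro x
    by_cases hx : c x = 3
    · rcases h.flip_of_three hx i with h2 | h2
      · rw [h2, if_pos hx, if_pos ⟨hx, by decide⟩]
        rfl
      · rw [h2, if_pos hx, if_neg (by simp)]
        rfl
    · simp [hx]
  simp only [h0, h3, ← mul_sum, ← card_filter] at hsum
  have := h.card_cells.1
  omega

lemma card_three_flip_eq (h : IsColoring c) (i : Fin 13) :
    #{y | c y = 3 ∧ c (flip y i) = 3} = 128 := by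
  have h1 := card_filter_add_card_filter_not (s := ({y | c y = 3} : Finset Word))
    (fun y => c (flip y i) = 3)
  simp only [filter_filter] at h1
  have h2 := h.card_three_flip_ne i
  have h3 := h.card_cells.2
  simp only [Ne] at h2
  omega

lemma isCube_neg (h : IsColoring c) {t : Fin 13 → ZMod 3} (ht : IsCube c t) : IsCube c (-t) :=
  ⟨(weight_neg t).trans ht.1, fun x hx => (h.shell ht).2.2 x ((dis_of_agrees_neg hx).trans ht.1)⟩

lemma three_le_conflict (h : IsColoring c) {t s : Fin 13 → ZMod 3} (ht : IsCube c t)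
    (hs : IsCube c s) (hne : s ≠ t) : 3 ≤ conflict t s := by
  obtain ⟨y, hy, hd⟩ := exists_agrees_dis_eq_conflict t s
  have h12 := (h.shell ht).2.1 y (hs.2 y hy)
  have h0 : dis t y ≠ 0 := fun h0 =>
    hne ((h.cubeWord_eq hs hy).symm.trans (h.cubeWord_eq ht (dis_eq_zero.1 h0)))
  omega

lemma ne_neg_of_isCube {t : Fin 13 → ZMod 3} (ht : IsCube c t) : t ≠ -t := by
  intro heq
  have h9 := ht.1
  have : ∀ i, t i = 0 := fun i => by
    have key : ∀ a : ZMod 3, a = -a → a = 0 := by decide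
    exact key _ (congrFun heq i)
  simp [this] at h9

lemma sum_overlap (h : IsColoring c) {t : Fin 13 → ZMod 3} (ht : IsCube c t) :
    ∑ y with c y = 3, overlap t (cubeWord c y) = 2592 := by
  simp only [overlap, card_filter]
  rw [sum_comm]
  have key : ∀ i, ∑ y with c y = 3, (if t i ≠ 0 ∧ cubeWord c y i ≠ 0 then 1 else 0) =
      288 * if t i ≠ 0 then 1 else 0 := by
    intro i
    by_cases hi : t i = 0
    · simp [hi]
    · rw [if_pos hi, mul_one, ← h.card_three_flip_ne i, ← card_filter, filter_filter]
      simp [hi, cubeWord_eq_zero]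
  simp only [key, ← mul_sum]
  rw [← card_filter, ht.1]
  norm_num

lemma overlap_eq_six (h : IsColoring c) {t s : Fin 13 → ZMod 3} (ht : IsCube c t)
    (hs : IsCube c s) (hne : s ≠ t) (hne' : s ≠ -t) : overlap t s = 6 := by
  have lower : ∀ u, IsCube c u → u ≠ t → u ≠ -t → 6 ≤ overlap t u := by
    intro u hu h1 h2
    have c1 := h.three_le_conflict ht hu h1
    have c2 := h.three_le_conflict ht (h.isCube_neg hu) fun heq => h2 (by rw [← heq, neg_neg])
    have := conflict_add_conflict_neg t u
    omega
  -- The pointwise lower bound for the overlap: 6 in general, 9 for the words `t` and `-t`. Its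
  -- total 6·416 + 3·16 + 3·16 = 2592 equals the true sum 9·288, so equality holds at every vertex.
  let g : Word → ℕ := fun y =>
    6 + (3 * (if cubeWord c y = t then 1 else 0) + 3 * if cubeWord c y = -t then 1 else 0)
  have hg : ∑ y with c y = 3, g y = 2592 := by
    simp only [g, sum_add_distrib, ← mul_sum, sum_const, ← card_filter, filter_filter]
    rw [h.card_cells.2, h.card_cubeWord_eq ht, h.card_cubeWord_eq (h.isCube_neg ht)]
    rfl
  have hle : ∀ y ∈ ({y | c y = 3} : Finset Word), g y ≤ overlap t (cubeWord c y) := by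
    intro y hy
    have hu := h.isCube_cubeWord (mem_filter.1 hy).2
    have hself : overlap t t = 9 := by
      rw [← ht.1]
      simp [overlap]
    by_cases h1 : cubeWord c y = t
    · simp [g, h1, ne_neg_of_isCube ht, hself]
    · by_cases h2 : cubeWord c y = -t
      · have : overlap t (-t) = 9 := by
          rw [← hself]
          simp [overlap]
        simp [g, h2, (ne_neg_of_isCube ht).symm, this]
      · simpa [g, h1, h2] using lower _ hu h1 h2
  obtain ⟨y, hy⟩ := exists_agrees s
  have hcy := h.cubeWord_eq hs hy
  have := (sum_eq_sum_iff_of_le hle).1 (hg.trans (h.sum_overlap ht).symm) y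
    (by simpa using hs.2 y hy)
  rw [hcy] at this
  simpa [g, hcy, hne, hne'] using this.symm

/-! ### Closure of the cube words under addition -/

lemma sum_mul_sgn_of_isCube (h : IsColoring c) {t : Fin 13 → ZMod 3} (ht : IsCube c t) {z : Word}
    (hz : c z = 0) : ∑ i, t i * sgn (z i) = 0 := by
  rw [sum_mul_sgn_eq_zero_iff ht.1]
  rcases (h.shell ht).1 z hz with h3 | h6
  · exact ⟨1, h3⟩
  · exact ⟨2, h6⟩

lemma dis_flip_le (t : Fin 13 → ZMod 3) (x : Word) (i : Fin 13) : dis t (flip x i) ≤ dis t x + 1 := by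
  have := dis_flip_add t x i
  split_ifs at this <;> omega

/-- If a code word lay in the subcube, a neighbor of it inside the subcube would be in cell 1 with
its 9 neighbors outside the subcube all in cell 2, but only 6 are allowed. -/
lemma not_agrees_of_dvd (h : IsColoring c) {u : Fin 13 → ZMod 3} (hu : #{i | u i ≠ 0} = 9)
    (hdvd : ∀ z, c z = 0 → 3 ∣ dis u z) {z : Word} (hz : c z = 0) : dis u z ≠ 0 := by
  intro hd
  have h4 := card_eq_zero_of_weight hu
  obtain ⟨b, hb⟩ := card_pos.1 (by rw [h4]; norm_num : 0 < #{i | u i = 0})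
  have hb : u b = 0 := (mem_filter.1 hb).2
  have hw1 : c (flip z b) = 1 := h.flip_of_zero hz b
  have hwd : dis u (flip z b) = 0 := by
    have := dis_flip_add u z b
    simpa [hb, hd] using this
  have hsub : ({q | u q ≠ 0} : Finset (Fin 13)) ⊆
      ({q | c (flip (flip z b) q) = 2} : Finset (Fin 13)) := by
    intro q hq
    have hq : u q ≠ 0 := (mem_filter.1 hq).2
    have hvd : dis u (flip (flip z b) q) = 1 := by
      have := dis_flip_add u (flip z b) q
      have hag := dis_eq_zero.1 hwd q hq
      simpa [hq, hag, hwd] using this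
    have n0 : c (flip (flip z b) q) ≠ 0 := fun h0 => by
      have := hdvd _ h0
      omega
    have n3 := h.ne_of_eq_zero (x := flip z b) (j := 3) (by rw [hw1]; rfl) q
    -- A code word next to it has distance at most 2, hence 0 by divisibility; re-entering the
    -- subcube undoes the flip at `q`, but that leads back to a vertex of cell 1.
    have n1 : c (flip (flip z b) q) ≠ 1 := fun h1 => by
      obtain ⟨k, hk⟩ := h.exists_flip (x := flip (flip z b) q) (j := 0) (by rw [h1]; decide)
      have hdk := hdvd _ hk
      have := dis_flip_le u (flip (flip z b) q) k
      have h0 : dis u (flip (flip (flip z b) q) k) = 0 := by omega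
      by_cases hkq : k = q
      · rw [hkq, flip_flip, hw1] at hk
        exact absurd hk (by decide)
      · have h1 := dis_eq_zero.1 h0 q hq
        rw [flip_apply_of_ne _ (Ne.symm hkq), flip_apply_self, sgn_add_one,
          dis_eq_zero.1 hwd q hq] at h1
        have key : ∀ a : ZMod 3, -a = a → a = 0 := by decide
        exact hq (key _ h1)
    simp only [mem_filter, mem_univ, true_and]
    generalize c (flip (flip z b) q) = a at *
    clear hvd
    decide +revert
  have := card_le_card hsub
  rw [hu, h, hw1] at this
  exact absurd this (by decide)

/-- Code words are at distance at least 3, so cell 1 is at distance at least 2 and cell 2 at least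
1; only cell 3 is left for the subcube. -/
lemma isCube_of_dvd (h : IsColoring c) {u : Fin 13 → ZMod 3} (hu : #{i | u i ≠ 0} = 9)
    (hdvd : ∀ z, c z = 0 → 3 ∣ dis u z) : IsCube c u := by
  refine ⟨hu, fun x hx => ?_⟩
  rw [← dis_eq_zero] at hx
  have far : ∀ z, c z = 0 → 3 ≤ dis u z := fun z hz => by
    have := hdvd z hz
    have := h.not_agrees_of_dvd hu hdvd hz
    omega
  have far1 : ∀ z, c z = 1 → 2 ≤ dis u z := fun z hz => by
    obtain ⟨k, hk⟩ := h.exists_flip (x := z) (j := 0) (by rw [hz]; decide)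
    have := far _ hk
    have := dis_flip_le u z k
    omega
  have n0 : c x ≠ 0 := fun h0 => by
    have := far x h0
    omega
  have n1 : c x ≠ 1 := fun h1 => by
    have := far1 x h1
    omega
  have n2 : c x ≠ 2 := fun h2 => by
    obtain ⟨k, hk⟩ := h.exists_flip (x := x) (j := 1) (by rw [h2]; decide)
    have := far1 _ hk
    have := dis_flip_le u x k
    omega
  generalize c x = a at *
  clear hx far far1 hdvd hu h
  decide +revert

lemma isCube_add (h : IsColoring c) {t s : Fin 13 → ZMod 3} (ht : IsCube c t)
    (hs : IsCube c s) : t + s = 0 ∨ IsCube c (t + s) := by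
  by_cases h1 : s = t
  · right
    have key : ∀ a : ZMod 3, a + a = -a := by decide
    have : t + s = -t := by
      rw [h1]
      exact funext fun i => key (t i)
    rw [this]
    exact h.isCube_neg ht
  by_cases h2 : s = -t
  · left
    rw [h2, add_neg_cancel]
  right
  have ho := h.overlap_eq_six ht hs h1 h2
  have c1 := h.three_le_conflict ht hs h1
  have c2 := h.three_le_conflict ht (h.isCube_neg hs) fun heq => h2 (by rw [← heq, neg_neg])
  have hc := conflict_add_conflict_neg t s
  have hw := weight_add t s
  rw [ht.1, hs.1] at hw
  -- The conflicts with `s` and `-s` are each at least 3 and add up to the overlap 6, so both are 3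
  -- and the weight is 9 + 9 - 6 - 3.
  have hu : #{i | (t + s) i ≠ 0} = 9 := by omega
  refine h.isCube_of_dvd hu fun z hz => ?_
  rw [← sum_mul_sgn_eq_zero_iff hu]
  simp only [Pi.add_apply, add_mul, sum_add_distrib, h.sum_mul_sgn_of_isCube ht hz,
    h.sum_mul_sgn_of_isCube hs hz, add_zero]

/-! ### The linear code of dimension 3 and its columns -/

/-- The ternary words of the subcubes of the last cell, together with the zero word, form a linear
code. -/
def cubeCode (h : IsColoring c) : Submodule (ZMod 3) (Fin 13 → ZMod 3) where
  carrier := {t | t = 0 ∨ IsCube c t}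
  zero_mem' := Or.inl rfl
  add_mem' := by
    rintro t s (rfl | ht) (rfl | hs)
    · exact Or.inl (add_zero 0)
    · rw [zero_add]
      exact Or.inr hs
    · rw [add_zero]
      exact Or.inr ht
    · exact h.isCube_add ht hs
  smul_mem' := by
    rintro a t (rfl | ht)
    · exact Or.inl (smul_zero a)
    · have key : ∀ a : ZMod 3, a = 0 ∨ a = 1 ∨ a = -1 := by decide
      rcases key a with rfl | rfl | rfl
      · exact Or.inl (zero_smul _ t)
      · rw [one_smul]
        exact Or.inr ht
      · rw [neg_one_smul]
        exact Or.inr (h.isCube_neg ht)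

lemma mem_cubeCode (h : IsColoring c) {t : Fin 13 → ZMod 3} :
    t ∈ h.cubeCode ↔ t = 0 ∨ IsCube c t := Iff.rfl

lemma card_cubeCode (h : IsColoring c) : Nat.card h.cubeCode = 27 := by
  classical
  have h416 := card_eq_sum_card_fiberwise (s := ({y | c y = 3} : Finset Word))
    (t := ({t | IsCube c t} : Finset (Fin 13 → ZMod 3))) (f := cubeWord c) (by
      intro y hy
      simpa using h.isCube_cubeWord (by simpa using hy))
  rw [h.card_cells.2, sum_congr rfl (g := fun _ => 16) (by
    intro t ht
    rw [filter_filter]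
    exact h.card_cubeWord_eq (mem_filter.1 ht).2), sum_const, smul_eq_mul] at h416
  have h0 : (0 : Fin 13 → ZMod 3) ∉ ({t | IsCube c t} : Finset (Fin 13 → ZMod 3)) := by
    intro hmem
    exact ne_neg_of_isCube (mem_filter.1 hmem).2 neg_zero.symm
  have hset : (h.cubeCode : Set (Fin 13 → ZMod 3)) =
      (insert 0 ({t | IsCube c t} : Finset (Fin 13 → ZMod 3)) : Finset _) := by
    ext t
    simp [mem_cubeCode]
  change Nat.card (h.cubeCode : Set (Fin 13 → ZMod 3)) = 27
  rw [hset, Nat.card_coe_set_eq, Set.ncard_coe_finset, card_insert_of_notMem h0]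
  omega

lemma finrank_cubeCode (h : IsColoring c) : Module.finrank (ZMod 3) h.cubeCode = 3 := by
  have h1 := Module.natCard_eq_pow_finrank (K := ZMod 3) (V := h.cubeCode)
  rw [h.card_cubeCode, Nat.card_zmod] at h1
  exact (Nat.pow_right_injective (le_refl 2 |>.trans (by norm_num) : 2 ≤ 3) h1).symm

lemma exists_isCube_ne_zero (h : IsColoring c) (i : Fin 13) : ∃ t, IsCube c t ∧ t i ≠ 0 := by
  obtain ⟨y, hy⟩ := card_pos.1 (by rw [h.card_three_flip_ne i]; norm_num :
    0 < #{y | c y = 3 ∧ c (flip y i) ≠ 3})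
  obtain ⟨h3, hne⟩ := (mem_filter.1 hy).2
  exact ⟨_, h.isCube_cubeWord h3, mt cubeWord_eq_zero.1 hne⟩

/-- Makes the columns at `i` and `j` nonproportional. The 128 vertices free at `i` exceed the 2·16
of one subcube and its antipode, so two words independent up to sign vanish at `i`; they have just
13 + 6 - 18 = 1 common zero. -/
lemma exists_isCube_separating (h : IsColoring c) {i j : Fin 13} (hij : i ≠ j) :
    ∃ t, IsCube c t ∧ t i = 0 ∧ t j ≠ 0 := by
  by_contra! hcon
  have h128 := h.card_three_flip_eq i
  obtain ⟨y, hy⟩ := card_pos.1 (by rw [h128]; norm_num : 0 < #{y | c y = 3 ∧ c (flip y i) = 3})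
  obtain ⟨hy3, hyi⟩ := (mem_filter.1 hy).2
  have ht := h.isCube_cubeWord hy3
  set t := cubeWord c y with htdef
  obtain ⟨y', hy', hnot⟩ := exists_mem_notMem_of_card_lt_card
    (s := ({y | c y = 3 ∧ cubeWord c y = t} : Finset Word) ∪
      ({y | c y = 3 ∧ cubeWord c y = -t} : Finset Word))
    (t := ({y | c y = 3 ∧ c (flip y i) = 3} : Finset Word)) (by
      refine (card_union_le _ _).trans_lt ?_
      rw [h.card_cubeWord_eq ht, h.card_cubeWord_eq (h.isCube_neg ht), h128]
      norm_num)
  obtain ⟨hy3', hyi'⟩ := (mem_filter.1 hy').2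
  simp only [mem_union, mem_filter, mem_univ, true_and, hy3', not_or] at hnot
  have hs := h.isCube_cubeWord hy3'
  have ho := h.overlap_eq_six ht hs hnot.1 hnot.2
  have hz := card_common_zeros t (cubeWord c y')
  rw [ht.1, hs.1, ho] at hz
  have hti : t i = 0 := cubeWord_eq_zero.2 hyi
  have hsi : cubeWord c y' i = 0 := cubeWord_eq_zero.2 hyi'
  have hone : #{k | t k = 0 ∧ cubeWord c y' k = 0} ≤ 1 := by omega
  exact hij (card_le_one.1 hone i (by simp [hti, hsi]) j
    (by simp [hcon t ht hti, hcon _ hs hsi]))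

end IsColoring

/-! ### Uniqueness up to equivalence -/

lemma exists_point_eq : ∀ v : Fin 3 → ZMod 3, v ≠ 0 →
    ∃ j : Fin 13, ∃ a : Fin 2, v = sgn a • point j := by
  decide

lemma sgn_add (a b : Fin 2) : sgn (a + b) = sgn a * sgn b := by decide +revert

lemma sgn_mul_self (a : Fin 2) : sgn a * sgn a = 1 := by decide +revert

/-- Up to equivalence, the zero cell of a coloring is contained in `hammingWords`. -/
lemma IsColoring.exists_perm {c : Word → Fin 4} (h : IsColoring c) :
    ∃ (π : Equiv.Perm (Fin 13)) (a : Fin 13 → Fin 2),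
      ∀ z, c z = 0 → ∃ x ∈ hammingWords, ∀ i, x (π i) + a i = z i := by
  let B := Module.finBasisOfFinrankEq (ZMod 3) h.cubeCode h.finrank_cubeCode
  -- The columns of a generator matrix; each is a signed projective point, the sign giving the
  -- symbol change and the point the new position.
  let g : Fin 13 → Fin 3 → ZMod 3 := fun i k => (B k : Fin 13 → ZMod 3) i
  have hg : ∀ t, IsCube c t → ∃ r : Fin 3 → ZMod 3, ∀ i, t i = ∑ k, r k * g i k := by
    intro t ht
    refine ⟨fun k => B.repr ⟨t, Or.inr ht⟩ k, fun i => ?_⟩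
    have := congrArg (fun u : h.cubeCode => (u : Fin 13 → ZMod 3) i)
      (B.sum_repr ⟨t, Or.inr ht⟩)
    simp only [Submodule.coe_sum, Submodule.coe_smul, Finset.sum_apply, Pi.smul_apply,
      smul_eq_mul] at this
    exact this.symm
  have hg0 : ∀ i, g i ≠ 0 := by
    intro i hi
    obtain ⟨t, ht, hne⟩ := h.exists_isCube_ne_zero i
    obtain ⟨r, hr⟩ := hg t ht
    exact hne (by rw [hr, hi]; simp)
  choose p a hpa using fun i => exists_point_eq (g i) (hg0 i)
  have hp : Function.Injective p := by
    intro i j hpij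
    by_contra hij
    obtain ⟨t, ht, hti, htj⟩ := h.exists_isCube_separating hij
    obtain ⟨r, hr⟩ := hg t ht
    have hgj : g j = (sgn (a j) * sgn (a i)) • g i := by
      rw [hpa i, hpa j, hpij, smul_smul, mul_assoc, sgn_mul_self, mul_one]
    apply htj
    have : t j = (sgn (a j) * sgn (a i)) * t i := by
      rw [hr, hr, hgj, mul_sum]
      exact sum_congr rfl fun k _ => by rw [Pi.smul_apply, smul_eq_mul]; ring
    rw [this, hti, mul_zero]
  let π : Equiv.Perm (Fin 13) := Equiv.ofBijective p (Finite.injective_iff_bijective.1 hp)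
  refine ⟨π, a, fun z hz => ⟨fun j => z (π.symm j) + a (π.symm j), fun k => ?_, fun i => ?_⟩⟩
  · rw [← Equiv.sum_comp π]
    simp only [Equiv.symm_apply_apply]
    have hterm : ∀ i, sgn (z i + a i) * point (π i) k = (B k : Fin 13 → ZMod 3) i * sgn (z i) := by
      intro i
      have : (B k : Fin 13 → ZMod 3) i = sgn (a i) * point (π i) k := congrFun (hpa i) k
      rw [this, sgn_add]
      ring
    simp only [hterm]
    rcases h.mem_cubeCode.1 (B k).2 with h0 | hcube
    · simp [h0]
    · exact h.sum_mul_sgn_of_isCube hcube hz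
  · have : a i + a i = 0 := congrFun (word_add_self a) i
    simp only [Equiv.symm_apply_apply, add_assoc, this, add_zero]

lemma ncard_zero_cell {c : Word → Fin 4} (h : IsColoring c) : {x | c x = 0}.ncard = 288 := by
  rw [← h.card_cells.1, ← Set.ncard_coe_finset]
  simp

/-- Every completely regular code with intersection array `{13, 6, 1; 1, 6, 9}` in `H(13,2)` is
equivalent to the one given by `hammingWords`. -/
lemma IsColoring.equivalent {c : Word → Fin 4} (h : IsColoring c) :
    Equivalent {x | hammingWordsCell x = 0} {x | c x = 0} := by
  obtain ⟨π, a, hπ⟩ := h.exists_perm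
  refine ⟨π, fun i => Equiv.addRight (a i), Eq.symm (Set.eq_of_subset_of_ncard_le ?_ ?_)⟩
  · intro z hz
    obtain ⟨x, hx, hxz⟩ := hπ z hz
    exact ⟨x, hammingWordsCell_eq_zero hx, funext hxz⟩
  · exact (Set.ncard_image_le (Set.toFinite _)).trans
      (by rw [ncard_zero_cell h, ncard_zero_cell isColoring_hammingWordsCell])

end CRCode

theorem mainTheorem2 :
    ∃ C : Set (Fin 13 → Fin 2),
      CRCode.IsCRCode (CRCode.hammingGraph 13 2) ![13, 6, 1] ![1, 6, 9] C ∧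
      ∀ D : Set (Fin 13 → Fin 2),
        CRCode.IsCRCode (CRCode.hammingGraph 13 2) ![13, 6, 1] ![1, 6, 9] D →
          CRCode.Equivalent C D := by
  refine ⟨_, CRCode.isColoring_hammingWordsCell.isCRCode, fun D hD => ?_⟩
  obtain ⟨c, hc, rfl⟩ := CRCode.exists_isColoring_of_isCRCode hD
  exact hc.equivalent
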